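/- Let $G$ be Hall's universal locally finite group, i.e. the Fraïssé limit of the class of finite groups: a countable locally finite group into which every finite group embeds, and such that for all finite groups $A, B$ and all embeddings $\rho: A\to G$ and $\iota: A\to B$ there is an embedding $\sigma: B\to G$ with $\sigma\circ\iota=\rho$. Let $\mathbb{U}$ be the Urysohn universal metric space, i.e. the completion of the rational Urysohn space, where the latter is the Fraïssé limit (in the same sense, with isometric embeddings) of the class of finite metric spaces with rational distances. Let $\mathrm{Iso}(\mathbb{U})$ be the group of all surjective isometries of $\mathbb{U}$ with the topology of pointwise convergence, and let $\mathrm{Hom}(G,\mathrm{Iso}(\mathbb{U}))$ be the space of all group homomorphisms $G\to\mathrm{Iso}(\mathbb{U})$ with the topology inherited from the product space $\mathrm{Iso}(\mathbb{U})^G$. Then there exists a Polish group $\mathbb{H}$ (a topological group whose topology is second countable and completely metrizable) such that the set of those $\alpha\in\mathrm{Hom}(G,\mathrm{Iso}(\mathbb{U}))$ for which the closure $\overline{\alpha[G]}$ of the image in $\mathrm{Iso}(\mathbb{U})$ is isomorphic, as a topological group, to $\mathbb{H}$ is comeager in $\mathrm{Hom}(G,\mathrm{Iso}(\mathbb{U}))$.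 -/

import Mathlib

universe u v

/-- Hall's universal locally finite group, as the Fraïssé limit of the class of finite groups:
a countable locally finite group (equivalently, a direct limit of a sequence of finite groups)
into which every finite group embeds and which has the extension property with respect to
embeddings of finite groups. These properties determine the group up to isomorphism. -/
structure IsHallGroup (G : Type u) [Group G] : Prop where
  countable : Countable G
  locallyFinite : ∀ H : Subgroup G, H.FG → Finite H
  universal : ∀ (A : Type u) [Group A] [Finite A], ∃ ρ : A →* G, Function.Injective ρ
  extension : ∀ (A B : Type u) [Group A] [Group B] [Finite A] [Finite B]
    (ρ : A →* G) (ι : A →* B), Function.Injective ρ → Function.Injective ι →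
      ∃ σ : B →* G, Function.Injective σ ∧ σ.comp ι = ρ

/-- All distances of the metric space `X` are rational. -/
def HasRationalDistances (X : Type*) [MetricSpace X] : Prop :=
  ∀ x y : X, ∃ r : ℚ, dist x y = (r : ℝ)

/-- The rational Urysohn space, as the Fraïssé limit of the class of finite metric spaces with
rational distances: a countable metric space with rational distances (equivalently, the union of
an increasing sequence of finite ones) into which every finite metric space with rational
distances embeds isometrically and which has the extension property with respect to isometric
embeddings of such spaces. These properties determine the space up to isometry. -/
structure IsRationalUrysohn (X : Type u) [MetricSpace X] : Prop where
  countable : Countable X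
  rational : HasRationalDistances X
  universal : ∀ (A : Type u) [MetricSpace A] [Finite A], HasRationalDistances A →
    ∃ ρ : A → X, Isometry ρ
  extension : ∀ (A B : Type u) [MetricSpace A] [MetricSpace B] [Finite A] [Finite B],
    HasRationalDistances A → HasRationalDistances B →
    ∀ (ρ : A → X) (ι : A → B), Isometry ρ → Isometry ι →
      ∃ σ : B → X, Isometry σ ∧ σ ∘ ι = ρ

/-- The Urysohn universal metric space: `U` is a completion of the rational Urysohn space, that
is, `U` is complete and has a dense subspace which is a rational Urysohn space. -/
structure IsUrysohnSpace (U : Type*) [MetricSpace U] : Prop where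
  complete : CompleteSpace U
  dense_rational : ∃ Q : Set U, Dense Q ∧ IsRationalUrysohn Q

/-- The topology of pointwise convergence on the group `X ≃ᵢ X` of all (surjective) isometries
of `X`. -/
instance isoTopology (X : Type*) [PseudoMetricSpace X] : TopologicalSpace (X ≃ᵢ X) :=
  TopologicalSpace.induced (fun φ : X ≃ᵢ X => (φ : X → X)) inferInstance

theorem continuous_iso_apply {X : Type*} [PseudoMetricSpace X] (x : X) :
    Continuous (fun φ : X ≃ᵢ X => φ x) :=
  (continuous_apply x).comp continuous_induced_dom

theorem continuous_iso_rng {X Y : Type*} [PseudoMetricSpace X] [TopologicalSpace Y]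
    {f : Y → (X ≃ᵢ X)} (h : ∀ x, Continuous (fun y => f y x)) : Continuous f :=
  continuous_induced_rng.2 (continuous_pi h)

instance isoTopologicalGroup (X : Type*) [PseudoMetricSpace X] :
    IsTopologicalGroup (X ≃ᵢ X) where
  continuous_mul := by
    refine continuous_iso_rng fun x => continuous_iff_continuousAt.2 fun p => ?_
    change Filter.Tendsto (fun q : (X ≃ᵢ X) × (X ≃ᵢ X) => q.1 (q.2 x)) (nhds p)
      (nhds (p.1 (p.2 x)))
    rw [tendsto_iff_dist_tendsto_zero]
    have h1 : Filter.Tendsto (fun q : (X ≃ᵢ X) × (X ≃ᵢ X) => dist (q.2 x) (p.2 x)) (nhds p)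
        (nhds 0) :=
      tendsto_iff_dist_tendsto_zero.1 (((continuous_iso_apply x).comp continuous_snd).tendsto p)
    have h2 : Filter.Tendsto (fun q : (X ≃ᵢ X) × (X ≃ᵢ X) =>
        dist (q.1 (p.2 x)) (p.1 (p.2 x))) (nhds p) (nhds 0) :=
      tendsto_iff_dist_tendsto_zero.1
        (((continuous_iso_apply (p.2 x)).comp continuous_fst).tendsto p)
    have h3 := h1.add h2
    rw [add_zero] at h3
    refine squeeze_zero (fun _ => dist_nonneg) (fun q => ?_) h3
    rw [← q.1.isometry.dist_eq (q.2 x) (p.2 x)]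
    exact dist_triangle _ _ _
  continuous_inv := by
    refine continuous_iso_rng fun x => continuous_iff_continuousAt.2 fun p => ?_
    change Filter.Tendsto (fun q : X ≃ᵢ X => q.symm x) (nhds p) (nhds (p.symm x))
    rw [tendsto_iff_dist_tendsto_zero]
    have h := tendsto_iff_dist_tendsto_zero.1 ((continuous_iso_apply (p.symm x)).tendsto p)
    refine h.congr fun q => ?_
    rw [← q.isometry.dist_eq (q.symm x) (p.symm x), q.apply_symm_apply, p.apply_symm_apply,
      dist_comm]

/-- The topology on the set `Hom(G, M)` of all homomorphisms from a (discrete) group `G` to a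
topological group `M`, as a subspace of the product space `M ^ G`. -/
instance homTopology (G M : Type*) [Group G] [Group M] [TopologicalSpace M] :
    TopologicalSpace (G →* M) :=
  TopologicalSpace.induced (fun f : G →* M => (f : G → M)) inferInstance

/-! The generic homomorphism has dense range, so the Polish group sought is `U ≃ᵢ U` itself. Since
this group is second countable, it suffices that for each nonempty open `O` the homomorphisms whose
range meets `O` form a dense open set; openness is immediate.

For density, a basic neighbourhood of `α₀` only involves a finite subgroup `F` of `G` and finitely
many points. Given `φ` in `O`, one seeks an action of `G` that is close on a finite set to `α₀` on
`F` and in which some `g` acts almost like `φ` (`IsHallGroup.exists_hom_dist_lt`). The construction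
has three stages. (1) Words in `F` and `φ` of bounded length are tested in a finite group containing
`F` (`exists_finite_group_lift`), which embeds in `G` over `F` by the extension property. (2) An
infimum over words, with a small penalty for length, gives a `G`-invariant pseudometric on `G × ℕ`
that almost reproduces the relevant distances in `U` (`exists_invariantPseudometric_of_freeGroup`).
(3) A Baire category argument perturbs it to one with the approximate extension property
(`exists_invariantPseudometric_approxExtension`). The completion is then a Urysohn space on which
`G` acts, and an isometry onto `U` that almost matches the prescribed points transports the action
(`exists_isometryEquiv_dist_le`). -/

/-! ### Katětov functions and extension properties -/

/-- `f` is a Katětov function on the family `a`: the values `f i` are admissible distances from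
a (possibly new) point to the points `a i`. -/
def IsKatetov {ι : Type*} {X : Type*} [PseudoMetricSpace X] (a : ι → X) (f : ι → ℝ) : Prop :=
  ∀ i j, f i - f j ≤ dist (a i) (a j) ∧ dist (a i) (a j) ≤ f i + f j

/-- Finite Katětov functions on `X` are approximately realized by points of `X`. -/
def ApproxExtension (X : Type*) [PseudoMetricSpace X] : Prop :=
  ∀ (n : ℕ) (a : Fin n → X) (f : Fin n → ℝ), IsKatetov a f →
    ∀ ε > 0, ∃ z, ∀ i, |dist z (a i) - f i| ≤ ε

/-- Finite Katětov functions on `X` are realized by points of `X`. -/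
def ExactExtension (X : Type*) [PseudoMetricSpace X] : Prop :=
  ∀ (n : ℕ) (a : Fin n → X) (f : Fin n → ℝ), IsKatetov a f → ∃ z, ∀ i, dist z (a i) = f i

theorem IsKatetov.nonneg {ι X : Type*} [PseudoMetricSpace X] {a : ι → X} {f : ι → ℝ}
    (h : IsKatetov a f) (i : ι) : 0 ≤ f i := by
  have := (h i i).2
  rw [dist_self] at this
  linarith

theorem IsKatetov.comp {ι κ X : Type*} [PseudoMetricSpace X] {a : ι → X} {f : ι → ℝ}
    (h : IsKatetov a f) (e : κ → ι) : IsKatetov (a ∘ e) (f ∘ e) :=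
  fun i j => h (e i) (e j)

theorem ApproxExtension.exists_of_finite {X : Type*} [PseudoMetricSpace X]
    (hX : ApproxExtension X) {ι : Type*} [Finite ι] {a : ι → X} {f : ι → ℝ} (h : IsKatetov a f)
    {ε : ℝ} (hε : 0 < ε) : ∃ z, ∀ i, |dist z (a i) - f i| ≤ ε := by
  obtain ⟨n, ⟨e⟩⟩ := Finite.exists_equiv_fin ι
  obtain ⟨z, hz⟩ := hX n _ _ (h.comp e.symm) ε hε
  exact ⟨z, fun i => by simpa using hz (e i)⟩

theorem ExactExtension.exists_of_finite {X : Type*} [PseudoMetricSpace X]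
    (hX : ExactExtension X) {ι : Type*} [Finite ι] {a : ι → X} {f : ι → ℝ} (h : IsKatetov a f) :
    ∃ z, ∀ i, dist z (a i) = f i := by
  obtain ⟨n, ⟨e⟩⟩ := Finite.exists_equiv_fin ι
  obtain ⟨z, hz⟩ := hX n _ _ (h.comp e.symm)
  exact ⟨z, fun i => by simpa using hz (e i)⟩

theorem ExactExtension.nonempty {X : Type*} [PseudoMetricSpace X] (hX : ExactExtension X) :
    Nonempty X :=
  let ⟨z, _⟩ := hX 0 Fin.elim0 Fin.elim0 fun i => i.elim0
  ⟨z⟩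

/-- A function which is Katětov up to an error `δ` is close to a Katětov function, whose values
are explicit. -/
theorem exists_isKatetov_near {ι X : Type*} [Finite ι] [PseudoMetricSpace X] {a : ι → X}
    {f : ι → ℝ} {δ : ℝ} (h₁ : ∀ i j, f i - f j ≤ dist (a i) (a j) + δ)
    (h₂ : ∀ i j, dist (a i) (a j) ≤ f i + f j + δ) :
    ∃ g, IsKatetov a g ∧ ∀ i, |g i - f i| ≤ δ ∧ ∃ j, g i = f j + dist (a i) (a j) + δ / 2 := by
  have hmin : ∀ i, ∃ j, ∀ k, f j + dist (a i) (a j) ≤ f k + dist (a i) (a k) := fun i =>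
    have : Nonempty ι := ⟨i⟩
    Finite.exists_min _
  choose m hm using hmin
  have hδ : ∀ i : ι, 0 ≤ δ := fun i => by
    have := h₁ i i
    rw [dist_self] at this
    linarith
  -- The minimum over `j` is the largest 1-Lipschitz function below `f`, and is at least `f - δ`.
  -- Raising every value by `δ / 2` absorbs the error in the second Katětov inequality.
  refine ⟨fun i => f (m i) + dist (a i) (a (m i)) + δ / 2, fun i j => ⟨?_, ?_⟩,
    fun i => ⟨?_, m i, rfl⟩⟩
  · have := hm i (m j)
    have := dist_triangle (a i) (a j) (a (m j))
    linarith
  · have := h₂ (m i) (m j)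
    have := dist_triangle4 (a i) (a (m i)) (a (m j)) (a j)
    rw [dist_comm (a (m j))] at this
    linarith
  · have h3 := hm i i
    have h4 := h₁ i (m i)
    have h5 := hδ i
    rw [dist_self] at h3
    rw [abs_le]
    constructor <;> linarith

/-- Each Katětov inequality involves two values and one distance, each off by at most `δ`; hence the
constant `3 * δ`. -/
theorem exists_isKatetov_near_of_dist {ι X Y : Type*} [Finite ι] [PseudoMetricSpace X]
    [PseudoMetricSpace Y] {a : ι → X} {b : ι → Y} {f g : ι → ℝ} {δ : ℝ} (h : IsKatetov a f)
    (hd : ∀ i j, |dist (b i) (b j) - dist (a i) (a j)| ≤ δ) (hf : ∀ i, |g i - f i| ≤ δ) :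
    ∃ g', IsKatetov b g' ∧
      ∀ i, |g' i - g i| ≤ 3 * δ ∧ ∃ j, g' i = g j + dist (b i) (b j) + 3 * δ / 2 := by
  refine exists_isKatetov_near (fun i j => ?_) (fun i j => ?_)
  · have h1 := abs_le.1 (hd i j)
    have h2 := abs_le.1 (hf i)
    have h3 := abs_le.1 (hf j)
    have := (h i j).1
    linarith
  · have h1 := abs_le.1 (hd i j)
    have h2 := abs_le.1 (hf i)
    have h3 := abs_le.1 (hf j)
    have := (h i j).2
    linarith

/-- Approximate extension passes from a dense subspace to the whole space. -/
theorem ApproxExtension.of_dense {N V : Type*} [PseudoMetricSpace N] [PseudoMetricSpace V]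
    (hN : ApproxExtension N) {q : N → V} (hq : Isometry q) (hd : DenseRange q) :
    ApproxExtension V := by
  intro n a f hf ε hε
  have : ∀ i, ∃ b, dist (a i) (q b) < ε / 10 := fun i => hd.exists_dist_lt (a i) (by positivity)
  choose b hb using this
  obtain ⟨g, hg, hgf⟩ := exists_isKatetov_near_of_dist (b := b) (g := f) (δ := ε / 5) hf
    (fun i j => by
      rw [← hq.dist_eq (b i) (b j)]
      have h1 := dist_triangle4 (a i) (q (b i)) (q (b j)) (a j)
      have h2 := dist_triangle4 (q (b i)) (a i) (a j) (q (b j))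
      have h3 := hb i
      have h4 := hb j
      rw [dist_comm (q (b j))] at h1
      rw [dist_comm (q (b i)) (a i)] at h2
      rw [abs_le]
      constructor <;> linarith) (fun i => by simpa using by positivity)
  obtain ⟨z, hz⟩ := hN n b g hg (ε / 10) (by positivity)
  refine ⟨q z, fun i => ?_⟩
  have h1 := hz i
  have h2 := (hgf i).1
  rw [← hq.dist_eq] at h1
  have h3 := hb i
  have h4 := dist_triangle (q z) (a i) (q (b i))
  have h5 := dist_triangle (q z) (q (b i)) (a i)
  rw [dist_comm (q (b i))] at h5
  rw [abs_le] at *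
  constructor <;> linarith

/-- A one-point extension of a metric space by a strictly positive Katětov function. -/
@[reducible] def optionMetricSpace {X : Type*} [MetricSpace X] (f : X → ℝ)
    (hf : IsKatetov id f) (hpos : ∀ x, 0 < f x) : MetricSpace (Option X) where
  dist x y := x.elim (y.elim 0 f) fun x => y.elim (f x) fun y => dist x y
  dist_self x := by cases x <;> simp
  dist_comm x y := by cases x <;> cases y <;> simp [dist_comm]
  dist_triangle x y z := by
    rcases x with _ | x <;> rcases y with _ | y <;> rcases z with _ | z <;> simp
    · exact (hpos y).le
    · have := (hf z y).1
      simp only [id, dist_comm z y] at this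
      linarith
    · exact (hf x z).2
    · have := (hf x y).1
      simp only [id] at this
      linarith
    · exact dist_triangle _ _ _
  eq_of_dist_eq_zero {x y} h := by
    rcases x with _ | x <;> rcases y with _ | y <;> simp at h
    · rfl
    · exact absurd h (hpos y).ne'
    · exact absurd h (hpos x).ne'
    · rw [h]

/-- The values are rounded up to rationals and then corrected to a Katětov function. The explicit
form of the correction keeps it rational, as `δ` is rational, and strictly positive, so the
one-point extension is a genuine metric space with rational distances. -/
theorem IsRationalUrysohn.approxExtension {X : Type u} [MetricSpace X]
    (hX : IsRationalUrysohn X) : ApproxExtension X := by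
  intro n a f hf ε hε
  obtain ⟨δ, hδ0, hδ⟩ := exists_rat_btwn (show 0 < ε / 4 by positivity)
  have hr : ∀ i, ∃ r : ℚ, f i < r ∧ (r : ℝ) < f i + δ := fun i =>
    exists_rat_btwn (by linarith)
  choose r hr1 hr2 using hr
  obtain ⟨g, hg, hgr⟩ := exists_isKatetov_near_of_dist (b := a) (g := fun i => (r i : ℝ))
    (δ := δ) hf (fun i j => by simpa using hδ0.le)
    (fun i => by rw [abs_le]; constructor <;> linarith [hr1 i, hr2 i])
  have hgpos : ∀ i, 0 < g i := fun i => by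
    obtain ⟨j, hj⟩ := (hgr i).2
    have := hf.nonneg j
    have := hr1 j
    have := dist_nonneg (x := a i) (y := a j)
    linarith
  have hgrat : ∀ i, ∃ s : ℚ, g i = s := fun i => by
    obtain ⟨j, hj⟩ := (hgr i).2
    obtain ⟨s, hs⟩ := hX.rational (a i) (a j)
    exact ⟨r j + s + 3 * δ / 2, by rw [hj, hs]; push_cast; ring⟩
  let A := Set.range a
  have hA : ∀ x : A, ∃ i, a i = x := fun x => x.2
  choose c hc using hA
  let F : A → ℝ := fun x => g (c x)
  have hF : IsKatetov (id : A → A) F := fun x y => by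
    have := hg (c x) (c y)
    rwa [hc, hc] at this
  let : MetricSpace (Option A) := optionMetricSpace F hF fun x => hgpos _
  have hAr : HasRationalDistances A := fun x y => hX.rational x y
  have hBr : HasRationalDistances (Option A) := fun x y => by
    rcases x with _ | x <;> rcases y with _ | y
    · exact ⟨0, by simp⟩
    · exact hgrat _
    · exact hgrat _
    · exact hX.rational x y
  obtain ⟨σ, hσ, hσι⟩ := hX.extension A (Option A) hAr hBr Subtype.val some isometry_subtype_coe
    (Isometry.of_dist_eq fun x y => rfl)
  refine ⟨σ none, fun i => ?_⟩
  let x : A := ⟨a i, Set.mem_range_self i⟩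
  have h1 : σ (some x) = a i := congrFun hσι x
  have h2 : dist (σ none) (a i) = g (c x) := h1 ▸ hσ.dist_eq none (some x)
  -- The family `a` may repeat points, so `c x` need not be `i`; a Katětov function agrees on
  -- indices with the same point.
  have h3 : g (c x) = g i := by
    have h4 := (hg (c x) i).1
    have h5 := (hg i (c x)).1
    have h6 : a (c x) = a i := hc x
    rw [h6, dist_self] at h4 h5
    linarith
  rw [h2, h3]
  have h4 := abs_le.1 (hgr i).1
  have := hr1 i
  have := hr2 i
  rw [abs_le]
  constructor <;> linarith

/-- Adjoining `z` to the family with its worst error `s` as prescribed distance keeps the function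
Katětov, so a better approximation exists at distance about `s` from `z`. -/
theorem ApproxExtension.improve {X : Type*} [PseudoMetricSpace X] (hX : ApproxExtension X) {n : ℕ}
    {a : Fin n → X} {f : Fin n → ℝ} (hf : IsKatetov a f) {z : X} {δ η : ℝ} (hδ : 0 ≤ δ)
    (hz : ∀ i, |dist z (a i) - f i| ≤ δ) (hη : 0 < η) :
    ∃ z', dist z z' ≤ δ + η ∧ ∀ i, |dist z' (a i) - f i| ≤ η := by
  -- For `n = 0` this supremum takes the default value `0`, which is the right one here.
  let s : ℝ := ⨆ i, |dist z (a i) - f i|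
  have hs0 : 0 ≤ s := Real.iSup_nonneg fun i => abs_nonneg _
  have hsδ : s ≤ δ := Real.iSup_le hz hδ
  have hsi : ∀ i, |dist z (a i) - f i| ≤ s := fun i =>
    le_ciSup (f := fun i => |dist z (a i) - f i|) (Set.finite_range _).bddAbove i
  have hsf : ∀ i, s ≤ dist z (a i) + f i := fun i => by
    have : Nonempty (Fin n) := ⟨i⟩
    refine ciSup_le fun j => ?_
    have h1 := hf j i
    have h2 := dist_triangle z (a i) (a j)
    have h3 := dist_triangle (a j) z (a i)
    rw [dist_comm (a j) z] at h3
    rw [dist_comm (a i)] at h2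
    rw [abs_le]
    constructor <;> linarith
  have hK : IsKatetov (fun o : Option (Fin n) => o.elim z a) (fun o => o.elim s f) := by
    rintro (_ | i) (_ | j)
    · simpa using hs0
    · have := abs_le.1 (hsi j)
      have := hsf j
      simp only [Option.elim]
      constructor <;> linarith
    · have := abs_le.1 (hsi i)
      have := hsf i
      simp only [Option.elim, dist_comm (a i) z]
      constructor <;> linarith
    · exact hf i j
  obtain ⟨z', hz'⟩ := hX.exists_of_finite hK hη
  refine ⟨z', ?_, fun i => hz' (some i)⟩
  have := abs_le.1 (hz' none)
  simp only [Option.elim] at this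
  rw [dist_comm]
  linarith

/-- In a complete space, approximate extension implies exact extension. -/
theorem ApproxExtension.exactExtension {X : Type*} [PseudoMetricSpace X] [CompleteSpace X]
    (hX : ApproxExtension X) : ExactExtension X := by
  intro n a f hf
  let P : ℕ → Type _ := fun k => {z : X // ∀ i, |dist z (a i) - f i| ≤ (1 / 2 : ℝ) ^ k}
  -- The step length is at most `(1 / 2) ^ k + (1 / 2) ^ (k + 1)`; the bound is written in the shape
  -- `C / 2 / 2 ^ k` required by `cauchySeq_of_le_geometric_two`.
  have step : ∀ k (z : P k), ∃ z' : P (k + 1), dist z.1 z'.1 ≤ 4 / 2 / 2 ^ k := fun k z => by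
    obtain ⟨z', h1, h2⟩ := hX.improve hf (by positivity) z.2
      (show (0 : ℝ) < (1 / 2) ^ (k + 1) by positivity)
    refine ⟨⟨z', h2⟩, h1.trans ?_⟩
    have : (0 : ℝ) < (1 / 2) ^ k := by positivity
    rw [pow_succ, div_eq_mul_inv (4 / 2 : ℝ), ← inv_pow, ← one_div (2 : ℝ)]
    linarith
  choose next hnext using step
  obtain ⟨z0, hz0⟩ := hX n a f hf 1 one_pos
  let z : ∀ k, P k := fun k => Nat.rec ⟨z0, by simpa using hz0⟩ next k
  have hz : ∀ k, dist (z k).1 (z (k + 1)).1 ≤ 4 / 2 / 2 ^ k := fun k => hnext k (z k)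
  obtain ⟨w, hw⟩ := cauchySeq_tendsto_of_complete (cauchySeq_of_le_geometric_two hz)
  refine ⟨w, fun i => ?_⟩
  have h1 : Filter.Tendsto (fun k => |dist (z k).1 (a i) - f i|) Filter.atTop
      (nhds |dist w (a i) - f i|) := ((hw.dist tendsto_const_nhds).sub tendsto_const_nhds).abs
  have h2 : |dist w (a i) - f i| ≤ 0 := le_of_tendsto_of_tendsto' h1
    (tendsto_pow_atTop_nhds_zero_of_lt_one (by norm_num) (by norm_num : (1 / 2 : ℝ) < 1))
    fun k => (z k).2 i
  exact sub_eq_zero.1 (abs_nonpos_iff.1 h2)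

theorem IsUrysohnSpace.exactExtension {U : Type u} [MetricSpace U] (hU : IsUrysohnSpace U) :
    ExactExtension U := by
  have := hU.complete
  obtain ⟨Q, hQd, hQ⟩ := hU.dense_rational
  exact (hQ.approxExtension.of_dense isometry_subtype_coe hQd.denseRange_val).exactExtension

theorem IsUrysohnSpace.separableSpace {U : Type u} [MetricSpace U] (hU : IsUrysohnSpace U) :
    TopologicalSpace.SeparableSpace U := by
  obtain ⟨Q, hQd, hQ⟩ := hU.dense_rational
  exact ⟨Q, hQ.countable, hQd⟩

/-! ### Partial isometries and back and forth -/

/-- Two completions of the same pseudometric space are isometric over it. -/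
theorem exists_isometryEquiv_of_dense {T V U : Type*} [PseudoMetricSpace T] [MetricSpace V]
    [CompleteSpace V] [MetricSpace U] [CompleteSpace U] {i : T → V} {j : T → U} (hi : Isometry i)
    (hj : Isometry j) (hid : DenseRange i) (hjd : DenseRange j) :
    ∃ η : V ≃ᵢ U, ∀ t, η (i t) = j t := by
  let p : AbstractCompletion T := ⟨V, i, inferInstance, inferInstance, inferInstance,
    hi.isUniformInducing, hid⟩
  let q : AbstractCompletion T := ⟨U, j, inferInstance, inferInstance, inferInstance,
    hj.isUniformInducing, hjd⟩
  let η : V ≃ᵤ U := p.compareEquiv q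
  have hη : ∀ t, η (i t) = j t := fun t => p.compare_coe q t
  refine ⟨⟨η.toEquiv, Isometry.of_dist_eq fun x y => ?_⟩, hη⟩
  have hc : Continuous η := η.continuous
  refine isClosed_property2 (p := fun x y => dist (η x) (η y) = dist x y) hid
    (isClosed_eq ((hc.comp continuous_fst).dist (hc.comp continuous_snd)) continuous_dist)
    (fun s t => ?_) x y
  rw [hη, hη, hi.dist_eq, hj.dist_eq]

/-- A set of pairs which is the graph of a partial isometry. -/
def IsPartialIsometry {V U : Type*} [PseudoMetricSpace V] [PseudoMetricSpace U]
    (R : Set (V × U)) : Prop :=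
  ∀ p ∈ R, ∀ q ∈ R, dist p.1 q.1 = dist p.2 q.2

theorem IsPartialIsometry.exists_insert_right {V U : Type*} [PseudoMetricSpace V]
    [PseudoMetricSpace U] (hU : ExactExtension U) {R : Set (V × U)} (hfin : R.Finite)
    (hR : IsPartialIsometry R) (v : V) : ∃ u, IsPartialIsometry (insert (v, u) R) := by
  have := hfin.to_subtype
  obtain ⟨u, hu⟩ := hU.exists_of_finite (a := fun p : R => p.1.2) (f := fun p => dist v p.1.1)
    fun p q => by
      rw [← hR p p.2 q q.2]
      have h1 := dist_triangle v q.1.1 p.1.1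
      have h2 := dist_triangle_left p.1.1 q.1.1 v
      rw [dist_comm q.1.1] at h1
      constructor <;> linarith
  refine ⟨u, ?_⟩
  rintro p (rfl | hp) q (rfl | hq)
  · simp
  · exact (hu ⟨q, hq⟩).symm
  · rw [dist_comm, dist_comm p.2]
    exact (hu ⟨p, hp⟩).symm
  · exact hR p hp q hq

theorem IsPartialIsometry.exists_insert_left {V U : Type*} [PseudoMetricSpace V]
    [PseudoMetricSpace U] (hV : ExactExtension V) {R : Set (V × U)} (hfin : R.Finite)
    (hR : IsPartialIsometry R) (u : U) : ∃ v, IsPartialIsometry (insert (v, u) R) := by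
  have h : IsPartialIsometry (Prod.swap '' R) := by
    rintro _ ⟨p, hp, rfl⟩ _ ⟨q, hq, rfl⟩
    exact (hR p hp q hq).symm
  obtain ⟨v, hv⟩ := h.exists_insert_right hV (hfin.image _) u
  refine ⟨v, fun p hp q hq => (hv p.swap ?_ q.swap ?_).symm⟩
  · rcases hp with rfl | hp
    · exact Or.inl rfl
    · exact Or.inr ⟨p, hp, rfl⟩
  · rcases hq with rfl | hq
    · exact Or.inl rfl
    · exact Or.inr ⟨q, hq, rfl⟩

theorem IsPartialIsometry.exists_extend_finite {W U : Type*} [PseudoMetricSpace W]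
    [PseudoMetricSpace U] (hU : ExactExtension U) {R : Set (W × U)} (hfin : R.Finite)
    (hR : IsPartialIsometry R) {T : Set W} (hT : T.Finite) :
    ∃ R', R ⊆ R' ∧ R'.Finite ∧ IsPartialIsometry R' ∧ ∀ w ∈ T, ∃ u, (w, u) ∈ R' := by
  induction T, hT using Set.Finite.induction_on with
  | empty => exact ⟨R, subset_rfl, hfin, hR, by simp⟩
  | @insert w T _ _ ih =>
    obtain ⟨R', h1, h2, h3, h4⟩ := ih
    obtain ⟨u, hu⟩ := h3.exists_insert_right hU h2 w
    refine ⟨_, h1.trans (Set.subset_insert _ _), h2.insert _, hu, ?_⟩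
    rintro x (rfl | hx)
    · exact ⟨u, Set.mem_insert _ _⟩
    · obtain ⟨y, hy⟩ := h4 x hx
      exact ⟨y, Set.mem_insert_of_mem _ hy⟩

/-- A partial isometry with dense domain and dense range extends to an isometry. -/
theorem IsPartialIsometry.exists_isometryEquiv_of_denseRange {V U : Type*} [MetricSpace V]
    [CompleteSpace V] [MetricSpace U] [CompleteSpace U] {T : Set (V × U)}
    (hT : IsPartialIsometry T) (hid : DenseRange fun p : T => p.1.1)
    (hjd : DenseRange fun p : T => p.1.2) : ∃ η : V ≃ᵢ U, ∀ p ∈ T, η p.1 = p.2 := by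
  have hi : Isometry (fun p : T => p.1.1) := Isometry.of_dist_eq fun p q => by
    rw [Subtype.dist_eq, Prod.dist_eq, ← hT p p.2 q q.2, max_self]
  have hj : Isometry (fun p : T => p.1.2) := Isometry.of_dist_eq fun p q => by
    rw [Subtype.dist_eq, Prod.dist_eq, hT p p.2 q q.2, max_self]
  obtain ⟨η, hη⟩ := exists_isometryEquiv_of_dense hi hj hid hjd
  exact ⟨η, fun p hp => hη ⟨p, hp⟩⟩

/-- Back and forth: a finite partial isometry between complete separable spaces with the exact
extension property extends to an isometry. -/
theorem IsPartialIsometry.exists_isometryEquiv {V U : Type*} [MetricSpace V] [CompleteSpace V]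
    [TopologicalSpace.SeparableSpace V] [MetricSpace U] [CompleteSpace U]
    [TopologicalSpace.SeparableSpace U] (hV : ExactExtension V) (hU : ExactExtension U)
    {R : Set (V × U)} (hfin : R.Finite) (hR : IsPartialIsometry R) :
    ∃ η : V ≃ᵢ U, ∀ p ∈ R, η p.1 = p.2 := by
  have := hV.nonempty
  have := hU.nonempty
  let P := {S : Set (V × U) // S.Finite ∧ IsPartialIsometry S}
  -- Forth for the dense sequence of `V`, back for that of `U`; an ideal meeting all these cofinal
  -- sets has as union a partial isometry with dense domain and range.
  let D : ℕ ⊕ ℕ → Order.Cofinal P := Sum.elim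
    (fun n => ⟨{S | ∃ u, (TopologicalSpace.denseSeq V n, u) ∈ S.1}, fun S =>
      let ⟨u, hu⟩ := S.2.2.exists_insert_right hU S.2.1 (TopologicalSpace.denseSeq V n)
      ⟨⟨_, S.2.1.insert _, hu⟩, ⟨u, Set.mem_insert _ _⟩, Set.subset_insert _ _⟩⟩)
    (fun n => ⟨{S | ∃ v, (v, TopologicalSpace.denseSeq U n) ∈ S.1}, fun S =>
      let ⟨v, hv⟩ := S.2.2.exists_insert_left hV S.2.1 (TopologicalSpace.denseSeq U n)
      ⟨⟨_, S.2.1.insert _, hv⟩, ⟨v, Set.mem_insert _ _⟩, Set.subset_insert _ _⟩⟩)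
  let R₀ : P := ⟨R, hfin, hR⟩
  let I := Order.idealOfCofinals R₀ D
  let T : Set (V × U) := {p | ∃ S ∈ I, p ∈ S.1}
  have hT : IsPartialIsometry T := by
    rintro p ⟨S, hS, hp⟩ q ⟨S', hS', hq⟩
    obtain ⟨S'', -, h1, h2⟩ := I.directed S hS S' hS'
    exact S''.2.2 p (h1 hp) q (h2 hq)
  have hid : DenseRange (fun p : T => p.1.1) := by
    refine (TopologicalSpace.denseRange_denseSeq V).mono ?_
    rintro _ ⟨n, rfl⟩
    obtain ⟨S, ⟨u, hu⟩, hS⟩ := Order.cofinal_meets_idealOfCofinals R₀ D (Sum.inl n)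
    exact ⟨⟨_, S, hS, hu⟩, rfl⟩
  have hjd : DenseRange (fun p : T => p.1.2) := by
    refine (TopologicalSpace.denseRange_denseSeq U).mono ?_
    rintro _ ⟨n, rfl⟩
    obtain ⟨S, ⟨u, hu⟩, hS⟩ := Order.cofinal_meets_idealOfCofinals R₀ D (Sum.inr n)
    exact ⟨⟨_, S, hS, hu⟩, rfl⟩
  obtain ⟨η, hη⟩ := hT.exists_isometryEquiv_of_denseRange hid hjd
  exact ⟨η, fun p hp => hη p ⟨R₀, Order.mem_idealOfCofinals R₀ D, hp⟩⟩

/-- A finite family in `V` whose distances are close to those of a family in `U` can be moved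
close to the latter by an isometry. -/
theorem exists_isometryEquiv_dist_le {V U : Type*} [MetricSpace V] [CompleteSpace V]
    [TopologicalSpace.SeparableSpace V] [MetricSpace U] [CompleteSpace U]
    [TopologicalSpace.SeparableSpace U] (hV : ExactExtension V) (hU : ExactExtension U)
    {J : Type*} [Finite J] {p : J → V} {u : J → U} {ε : ℝ} (hε : 0 < ε)
    (h : ∀ i j, |dist (p i) (p j) - dist (u i) (u j)| ≤ 2 * ε) :
    ∃ η : V ≃ᵢ U, ∀ j, dist (η (p j)) (u j) ≤ ε := by
  rcases isEmpty_or_nonempty J with hJ | hJ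
  · obtain ⟨η, -⟩ := IsPartialIsometry.exists_isometryEquiv hV hU (R := ∅) Set.finite_empty
      (by simp [IsPartialIsometry])
    exact ⟨η, fun j => isEmptyElim j⟩
  -- In the glued space `p j` lies at distance `ε` from `u j`. Fixing the points `u j` and extending
  -- over the `p j` yields copies `q j` in `U` with the same mutual distances as the `p j`, still at
  -- distance `ε` from `u j`.
  let : MetricSpace (V ⊕ U) := Metric.glueMetricApprox p u ε hε h
  have hR₀ : IsPartialIsometry (Set.range fun j => ((Sum.inr (u j) : V ⊕ U), u j)) := by
    rintro _ ⟨i, rfl⟩ _ ⟨j, rfl⟩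
    rfl
  obtain ⟨R', h1, h2, h3, h4⟩ := hR₀.exists_extend_finite hU (Set.finite_range _)
    (Set.finite_range fun j => (Sum.inl (p j) : V ⊕ U))
  have h4' : ∀ j, ∃ w, ((Sum.inl (p j) : V ⊕ U), w) ∈ R' := fun j => h4 _ ⟨j, rfl⟩
  choose q hq using h4'
  have hR : IsPartialIsometry (Set.range fun j => (p j, q j)) := by
    rintro _ ⟨i, rfl⟩ _ ⟨j, rfl⟩
    exact h3 _ (hq i) _ (hq j)
  obtain ⟨η, hη⟩ := hR.exists_isometryEquiv hV hU (Set.finite_range _)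
  refine ⟨η, fun j => ?_⟩
  have h5 : η (p j) = q j := hη _ ⟨j, rfl⟩
  rw [h5, ← h3 _ (hq j) _ (h1 ⟨j, rfl⟩)]
  exact (Metric.glueDist_glued_points p u ε j).le

/-! ### Topology of isometry groups and of spaces of homomorphisms -/

/-- Isometries are equicontinuous, so evaluation at any point is a uniform limit of evaluations at
points of the dense sequence. The values of the inverse are recorded to make the range closed. -/
theorem isEmbedding_isometryEquiv_pi_prod {U : Type*} [MetricSpace U] {u : ℕ → U}
    (hu : DenseRange u) :
    Topology.IsEmbedding fun φ : U ≃ᵢ U => (fun n => φ (u n), fun n => φ.symm (u n)) := by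
  refine ⟨⟨le_antisymm ?_ ?_⟩, fun φ ψ h => ?_⟩
  · exact ((continuous_pi fun n => continuous_iso_apply (u n)).prodMk
      (continuous_pi fun n => (continuous_iso_apply (u n)).comp continuous_inv)).le_induced
  · rw [← continuous_id_iff_le]
    let t : TopologicalSpace (U ≃ᵢ U) := TopologicalSpace.induced
      (fun φ : U ≃ᵢ U => (fun n => φ (u n), fun n => φ.symm (u n))) inferInstance
    have hc : @Continuous _ ((ℕ → U) × (ℕ → U)) t _
      (fun φ : U ≃ᵢ U => (fun n => φ (u n), fun n => φ.symm (u n))) := continuous_induced_dom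
    refine @continuous_iso_rng U (U ≃ᵢ U) _ t id fun x => ?_
    refine @continuous_of_uniform_approx_of_continuous _ _ t _ _ fun W hW => ?_
    obtain ⟨ε, hε, hεW⟩ := Metric.mem_uniformity_dist.1 hW
    obtain ⟨n, hn⟩ := hu.exists_dist_lt x hε
    refine ⟨fun φ => φ (u n), ?_, fun φ => hεW ?_⟩
    · exact (continuous_apply n).comp (continuous_fst.comp hc)
    · rwa [id, φ.isometry.dist_eq]
  · ext x
    have h1 : (φ : U → U) ∘ u = ψ ∘ u := congrArg Prod.fst h
    exact congrFun (hu.equalizer φ.continuous ψ.continuous h1) x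

/-- The equations say that the pairs `(u n, a n)` and `(b n, u n)` together form a partial isometry.
Its domain and range contain the dense sequence, so it extends to a surjective isometry. These are
closed conditions. -/
theorem range_isometryEquiv_pi_prod {U : Type*} [MetricSpace U] [CompleteSpace U] {u : ℕ → U}
    (hu : DenseRange u) :
    (Set.range fun φ : U ≃ᵢ U => ((fun n => φ (u n), fun n => φ.symm (u n)) : (ℕ → U) × (ℕ → U)))
      = {p | ∀ n m, dist (p.1 n) (p.1 m) = dist (u n) (u m) ∧
          dist (p.2 n) (p.2 m) = dist (u n) (u m) ∧ dist (p.1 n) (u m) = dist (u n) (p.2 m)} := by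
  ext ⟨a, b⟩
  constructor
  · rintro ⟨φ, h⟩ n m
    rw [← h]
    refine ⟨φ.dist_eq _ _, φ.symm.dist_eq _ _, ?_⟩
    rw [← φ.dist_eq (u n), φ.apply_symm_apply]
  · intro h
    have hT : IsPartialIsometry
        (Set.range fun k : ℕ ⊕ ℕ => k.elim (fun n => (u n, a n)) fun n => (b n, u n)) := by
      rintro _ ⟨n | n, rfl⟩ _ ⟨m | m, rfl⟩
      · exact (h n m).1.symm
      · exact (h n m).2.2.symm
      · simp only [Sum.elim_inr, Sum.elim_inl]
        rw [dist_comm, dist_comm (u n)]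
        exact (h m n).2.2.symm
      · exact (h n m).2.1
    obtain ⟨η, hη⟩ := hT.exists_isometryEquiv_of_denseRange
      (hu.mono <| by rintro _ ⟨n, rfl⟩; exact ⟨⟨_, Sum.inl n, rfl⟩, rfl⟩)
      (hu.mono <| by rintro _ ⟨n, rfl⟩; exact ⟨⟨_, Sum.inr n, rfl⟩, rfl⟩)
    refine ⟨η, Prod.ext (funext fun n => ?_) (funext fun n => ?_)⟩
    · exact hη _ ⟨Sum.inl n, rfl⟩
    · exact (IsometryEquiv.symm_apply_eq η).2 (hη _ ⟨Sum.inr n, rfl⟩).symm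

/-- The isometry group of a complete separable metric space is Polish. -/
theorem polishSpace_isometryEquiv (U : Type*) [MetricSpace U] [CompleteSpace U]
    [TopologicalSpace.SeparableSpace U] [Nonempty U] : PolishSpace (U ≃ᵢ U) := by
  have hu := TopologicalSpace.denseRange_denseSeq U
  have := UniformSpace.secondCountable_of_separable U
  refine Topology.IsClosedEmbedding.polishSpace ⟨isEmbedding_isometryEquiv_pi_prod hu, ?_⟩
  rw [range_isometryEquiv_pi_prod hu]
  simp only [Set.ofPred_forall, Set.ofPred_and]
  refine isClosed_iInter fun n => isClosed_iInter fun m => ?_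
  refine (isClosed_eq ?_ ?_).inter ((isClosed_eq ?_ ?_).inter (isClosed_eq ?_ ?_)) <;> fun_prop

theorem continuous_hom_apply {G M : Type*} [Group G] [Group M] [TopologicalSpace M] (g : G) :
    Continuous (fun α : G →* M => α g) :=
  (continuous_apply g).comp continuous_induced_dom

/-- A neighbourhood of an isometry contains all isometries which are close to it on a suitable
finite set. -/
theorem exists_finite_dist_lt_of_mem_nhds {U : Type*} [PseudoMetricSpace U] {φ : U ≃ᵢ U}
    {O : Set (U ≃ᵢ U)} (hO : O ∈ nhds φ) :
    ∃ (P : Set U) (ε : ℝ), P.Finite ∧ 0 < ε ∧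
      ∀ ψ : U ≃ᵢ U, (∀ x ∈ P, dist (ψ x) (φ x) < ε) → ψ ∈ O := by
  rw [nhds_induced, Filter.mem_comap] at hO
  obtain ⟨t, ht, htO⟩ := hO
  rw [nhds_pi, Filter.mem_pi] at ht
  obtain ⟨P, hP, s, hs, hst⟩ := ht
  have h1 : ∀ x, ∃ ε > 0, Metric.ball (φ x) ε ⊆ s x := fun x => Metric.mem_nhds_iff.1 (hs x)
  choose ε hε hεs using h1
  obtain ⟨δ, hδ, hδP⟩ : ∃ δ > 0, ∀ x ∈ P, δ ≤ ε x := by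
    rcases P.eq_empty_or_nonempty with rfl | hne
    · exact ⟨1, one_pos, by simp⟩
    · obtain ⟨x, hx, hmin⟩ := hP.exists_minimalFor ε P hne
      exact ⟨ε x, hε x, fun y hy => (le_total (ε x) (ε y)).elim id fun h => hmin hy h⟩
  exact ⟨P, δ, hP, hδ, fun ψ hψ => htO (hst fun x hx =>
    hεs x ((hψ x hx).trans_le (hδP x hx)))⟩

/-- A neighbourhood of a homomorphism into an isometry group contains all homomorphisms which are
close to it at a suitable finite set of group elements and a finite set of points. -/
theorem exists_finite_dist_lt_of_mem_nhds_hom {G U : Type*} [Group G] [PseudoMetricSpace U]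
    {α : G →* (U ≃ᵢ U)} {O : Set (G →* (U ≃ᵢ U))} (hO : O ∈ nhds α) :
    ∃ (T : Set G) (P : Set U) (ε : ℝ), T.Finite ∧ P.Finite ∧ 0 < ε ∧
      ∀ β : G →* (U ≃ᵢ U), (∀ g ∈ T, ∀ x ∈ P, dist (β g x) (α g x) < ε) → β ∈ O := by
  rw [nhds_induced, Filter.mem_comap] at hO
  obtain ⟨t, ht, htO⟩ := hO
  rw [nhds_pi, Filter.mem_pi] at ht
  obtain ⟨T, hT, s, hs, hst⟩ := ht
  have h1 := fun g => exists_finite_dist_lt_of_mem_nhds (hs g)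
  choose P ε hP hε hPs using h1
  obtain ⟨δ, hδ, hδT⟩ : ∃ δ > 0, ∀ x ∈ T, δ ≤ ε x := by
    rcases T.eq_empty_or_nonempty with rfl | hne
    · exact ⟨1, one_pos, by simp⟩
    · obtain ⟨x, hx, hmin⟩ := hT.exists_minimalFor ε T hne
      exact ⟨ε x, hε x, fun y hy => (le_total (ε x) (ε y)).elim id fun h => hmin hy h⟩
  exact ⟨T, ⋃ g ∈ T, P g, δ, hT, hT.biUnion fun g _ => hP g, hδ, fun β hβ => htO (hst fun g hg =>
    hPs g _ fun x hx => (hβ g hg x (Set.mem_biUnion hg hx)).trans_le (hδT g hg))⟩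

/-! ### Invariant pseudometrics and their generic extension property -/

/-- A Katětov function on a finite family extends to the whole space. -/
theorem IsKatetov.exists_extend {ι X : Type*} [Finite ι] [Nonempty ι] [PseudoMetricSpace X]
    {a : ι → X} {f : ι → ℝ} (h : IsKatetov a f) :
    ∃ F : X → ℝ, IsKatetov id F ∧ ∀ i, F (a i) = f i := by
  have hmin : ∀ x, ∃ j, ∀ k, f j + dist x (a j) ≤ f k + dist x (a k) := fun x =>
    Finite.exists_min _
  choose m hm using hmin
  refine ⟨fun x => f (m x) + dist x (a (m x)), fun x y => ⟨?_, ?_⟩, fun i => ?_⟩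
  · have := hm x (m y)
    have := dist_triangle x y (a (m y))
    simp only [id]
    linarith
  · have := (h (m x) (m y)).2
    have := dist_triangle4 x (a (m x)) (a (m y)) y
    rw [dist_comm (a (m y)) y] at this
    rw [id, id]
    linarith
  · have h1 := hm (a i) i
    have h2 := (h i (m (a i))).1
    rw [dist_self] at h1
    linarith

/-- The pseudometrics on `G × ℕ` which are invariant under left multiplication by `G` on the first
coordinate. -/
def invariantPseudometrics (G : Type*) [Group G] : Set ((G × ℕ) × (G × ℕ) → ℝ) :=
  {d | (∀ p, d (p, p) = 0) ∧ (∀ p q, d (p, q) = d (q, p)) ∧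
    (∀ p q r, d (p, r) ≤ d (p, q) + d (q, r)) ∧
    ∀ (g : G) (p q), d ((g * p.1, p.2), (g * q.1, q.2)) = d (p, q)}

/-- The pseudometric space structure given by an invariant pseudometric. -/
@[reducible] def invariantPseudoMetricSpace {G : Type*} [Group G] (d : invariantPseudometrics G) :
    PseudoMetricSpace (G × ℕ) where
  dist p q := d.1 (p, q)
  dist_self := d.2.1
  dist_comm := d.2.2.1
  dist_triangle := d.2.2.2.1

theorem isClosed_invariantPseudometrics (G : Type*) [Group G] :
    IsClosed (invariantPseudometrics G) := by
  simp only [invariantPseudometrics, Set.ofPred_and, Set.ofPred_forall]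
  refine .inter ?_ (.inter ?_ (.inter ?_ ?_))
  · exact isClosed_iInter fun p => isClosed_eq (continuous_apply _) continuous_const
  · exact isClosed_iInter fun p => isClosed_iInter fun q =>
      isClosed_eq (continuous_apply _) (continuous_apply _)
  · exact isClosed_iInter fun p => isClosed_iInter fun q => isClosed_iInter fun r =>
      isClosed_le (by fun_prop) (by fun_prop)
  · exact isClosed_iInter fun g => isClosed_iInter fun p => isClosed_iInter fun q =>
      isClosed_eq (continuous_apply _) (continuous_apply _)

/-- The orbit `G × {n}` can be moved so that the distances from `(1, n)` to the other orbits are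
given by a Katětov function. -/
theorem exists_invariantPseudometric_replace_orbit {G : Type*} [Group G]
    (d : invariantPseudometrics G) (n : ℕ) {f : G × ℕ → ℝ}
    (hf : ∀ p q, f p - f q ≤ d.1 (p, q) ∧ d.1 (p, q) ≤ f p + f q) :
    ∃ d' : invariantPseudometrics G,
      (∀ p q, p.2 ≠ n → q.2 ≠ n → d'.1 (p, q) = d.1 (p, q)) ∧
        ∀ q, q.2 ≠ n → d'.1 ((1, n), q) = f q := by
  obtain ⟨d, h0, hs, ht, hi⟩ := d
  -- Each point is represented by a Katětov function: translates of `f` for the orbit `n`, distance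
  -- functions elsewhere. The new pseudometric is the supremum distance between these functions, as
  -- in the Kuratowski embedding.
  let Φ : G × ℕ → G × ℕ → ℝ := fun p y => if p.2 = n then f (p.1⁻¹ * y.1, y.2) else d (p, y)
  have hΦ : ∀ p y z, Φ p y - Φ p z ≤ d (y, z) ∧ d (y, z) ≤ Φ p y + Φ p z := fun p y z => by
    simp only [Φ]
    split_ifs
    · rw [← hi p.1⁻¹ y z]
      exact hf _ _
    · have h1 := ht p z y
      have h2 := ht y p z
      rw [hs z y] at h1
      rw [hs y p] at h2
      constructor <;> linarith
  have hΦle : ∀ p q y z, |Φ p y - Φ q y| ≤ Φ p z + Φ q z := fun p q y z => by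
    have h1 := hΦ p y z
    have h2 := hΦ q y z
    rw [abs_le]
    constructor <;> linarith
  have hΦinv : ∀ g p y, Φ (g * p.1, p.2) (g * y.1, y.2) = Φ p y := fun g p y => by
    simp only [Φ, mul_inv_rev, mul_assoc, inv_mul_cancel_left]
    rw [hi g p y]
  have hbdd : ∀ p q, BddAbove (Set.range fun y => |Φ p y - Φ q y|) := fun p q =>
    ⟨_, by rintro _ ⟨y, rfl⟩; exact hΦle p q y p⟩
  let d' : (G × ℕ) × (G × ℕ) → ℝ := fun x => ⨆ y, |Φ x.1 y - Φ x.2 y|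
  have hs' : ∀ p q, d' (p, q) = d' (q, p) := fun p q => by
    simp only [d', abs_sub_comm]
  -- As `Φ p` vanishes at `p`, the supremum is attained at `y = p`.
  have hold : ∀ p q, p.2 ≠ n → d' (p, q) = Φ q p := fun p q hp => by
    have h1 : Φ p p = 0 := by simp only [Φ, if_neg hp, h0]
    refine le_antisymm (ciSup_le fun y => (hΦle p q y p).trans (by rw [h1, zero_add])) ?_
    refine le_trans ?_ (le_ciSup (hbdd p q) p)
    rw [h1, zero_sub, abs_neg]
    exact le_abs_self _
  refine ⟨⟨d', fun p => ?_, hs', fun p q r => ?_, fun g p q => ?_⟩, fun p q hp hq => ?_,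
    fun q hq => ?_⟩
  · simp [d']
  · exact ciSup_le fun y => (abs_sub_le _ (Φ q y) _).trans
      (add_le_add (le_ciSup (hbdd p q) y) (le_ciSup (hbdd q r) y))
  · refine (Equiv.iSup_congr ((Equiv.mulLeft g).prodCongr (Equiv.refl ℕ)) fun y => ?_).symm
    change |Φ (g * p.1, p.2) (g * y.1, y.2) - Φ (g * q.1, q.2) (g * y.1, y.2)| = |Φ p y - Φ q y|
    rw [hΦinv, hΦinv]
  · change d' (p, q) = d (p, q)
    rw [hold p q hp]
    simp only [Φ, if_neg hq]
    rw [hs]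
  · change d' ((1, n), q) = f q
    rw [hs', hold q _ hq]
    simp [Φ]

theorem exists_finite_eq_of_mem_nhds {G : Type*} [Group G] {d : invariantPseudometrics G}
    {O : Set (invariantPseudometrics G)} (hO : O ∈ nhds d) :
    ∃ A : Set (G × ℕ), A.Finite ∧
      ∀ d' : invariantPseudometrics G, (∀ p ∈ A, ∀ q ∈ A, d'.1 (p, q) = d.1 (p, q)) → d' ∈ O := by
  rw [nhds_subtype, Filter.mem_comap] at hO
  obtain ⟨t, ht, htO⟩ := hO
  rw [nhds_pi, Filter.mem_pi] at ht
  obtain ⟨B, hB, s, hs, hst⟩ := ht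
  refine ⟨Prod.fst '' B ∪ Prod.snd '' B, (hB.image _).union (hB.image _), fun d' h => htO (hst ?_)⟩
  intro x hx
  rw [show x = (x.1, x.2) from rfl, h x.1 (Or.inl ⟨x, hx, rfl⟩) x.2 (Or.inr ⟨x, hx, rfl⟩)]
  exact mem_of_mem_nhds (hs _)

/-- The invariant pseudometrics for which `r` is not an almost Katětov function on the family `a`,
or is almost realized. -/
def realizingPseudometrics {G : Type*} [Group G] {n : ℕ} (a : Fin n → G × ℕ) (r : Fin n → ℚ)
    (ε : ℝ) : Set (invariantPseudometrics G) :=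
  {d | (∃ i j, d.1 (a i, a j) + ε < r i - r j ∨ r i + r j + ε < d.1 (a i, a j)) ∨
    ∃ z, ∀ i, |d.1 (z, a i) - r i| < 2 * ε}

theorem isOpen_realizingPseudometrics {G : Type*} [Group G] {n : ℕ} (a : Fin n → G × ℕ)
    (r : Fin n → ℚ) (ε : ℝ) : IsOpen (realizingPseudometrics a r ε) := by
  have hc : ∀ x, Continuous fun d : invariantPseudometrics G => d.1 x := fun x =>
    (continuous_apply x).comp continuous_subtype_val
  simp only [realizingPseudometrics, Set.ofPred_or, Set.ofPred_exists, Set.ofPred_forall]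
  refine .union (isOpen_iUnion fun i => isOpen_iUnion fun j => .union ?_ ?_)
    (isOpen_iUnion fun z => isOpen_iInter_of_finite fun i => ?_)
  · exact isOpen_lt ((hc _).add continuous_const) continuous_const
  · exact isOpen_lt continuous_const (hc _)
  · exact isOpen_lt ((hc _).sub continuous_const).abs continuous_const

/-- A neighbourhood restricts only finitely many orbits, so an unused orbit `N` is free to be moved
to realize a Katětov function near `r`. -/
theorem dense_realizingPseudometrics {G : Type*} [Group G] {n : ℕ} (a : Fin n → G × ℕ)
    (r : Fin n → ℚ) {ε : ℝ} (hε : 0 < ε) : Dense (realizingPseudometrics a r ε) := by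
  refine dense_iff_inter_open.2 fun O hO ⟨d, hd⟩ => ?_
  rcases isEmpty_or_nonempty (Fin n) with hn | hn
  · exact ⟨d, hd, Or.inr ⟨(1, 0), fun i => isEmptyElim i⟩⟩
  by_cases hr : ∃ i j, d.1 (a i, a j) + ε < r i - r j ∨ r i + r j + ε < d.1 (a i, a j)
  · exact ⟨d, hd, Or.inl hr⟩
  push Not at hr
  let := invariantPseudoMetricSpace d
  obtain ⟨f, hf, hfr⟩ := exists_isKatetov_near (a := a) (f := fun i => (r i : ℝ)) (δ := ε)
    (fun i j => (hr i j).1) (fun i j => (hr i j).2)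
  obtain ⟨F, hF, hFf⟩ := hf.exists_extend
  obtain ⟨A, hA, hAO⟩ := exists_finite_eq_of_mem_nhds (hO.mem_nhds hd)
  obtain ⟨N, hN⟩ := ((hA.union (Set.finite_range a)).image Prod.snd).exists_notMem
  have hNA : ∀ p ∈ A ∪ Set.range a, p.2 ≠ N := fun p hp h => hN ⟨p, hp, h⟩
  obtain ⟨d', h1, h2⟩ := exists_invariantPseudometric_replace_orbit d N hF
  refine ⟨d', hAO d' fun p hp q hq => h1 p q (hNA p (Or.inl hp)) (hNA q (Or.inl hq)),
    Or.inr ⟨(1, N), fun i => ?_⟩⟩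
  rw [h2 _ (hNA _ (Or.inr ⟨i, rfl⟩)), hFf]
  exact (hfr i).1.trans_lt (by linarith)

/-- Every invariant pseudometric on `G × ℕ` can be perturbed to one with the approximate extension
property. -/
theorem exists_invariantPseudometric_approxExtension {G : Type*} [Group G] [Countable G]
    (d : invariantPseudometrics G) {A : Set (G × ℕ)} (hA : A.Finite) {ε : ℝ} (hε : 0 < ε) :
    ∃ d' : invariantPseudometrics G, (∀ p ∈ A, ∀ q ∈ A, |d'.1 (p, q) - d.1 (p, q)| < ε) ∧
      @ApproxExtension _ (invariantPseudoMetricSpace d') := by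
  -- Polish spaces are Baire, and `I` below is countable because only rational values and tolerances
  -- `1 / (k + 1)` are tested.
  have := (isClosed_invariantPseudometrics G).polishSpace
  let I := Σ n : ℕ, (Fin n → G × ℕ) × (Fin n → ℚ) × ℕ
  have hI : Dense (⋂ x : I, realizingPseudometrics x.2.1 x.2.2.1 (1 / ((x.2.2.2 : ℝ) + 1))) :=
    dense_iInter_of_isOpen (fun x => isOpen_realizingPseudometrics _ _ _)
      fun x => dense_realizingPseudometrics _ _ (by positivity)
  have hO : IsOpen {d' : invariantPseudometrics G |
      ∀ p ∈ A, ∀ q ∈ A, |d'.1 (p, q) - d.1 (p, q)| < ε} := by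
    simp only [Set.ofPred_forall]
    refine hA.isOpen_biInter fun p _ => hA.isOpen_biInter fun q _ => ?_
    exact isOpen_lt (((continuous_apply _).comp continuous_subtype_val).sub
      continuous_const).abs continuous_const
  obtain ⟨d', h1, h2⟩ := hI.inter_open_nonempty _ hO ⟨d, fun p _ q _ => by simpa using hε⟩
  refine ⟨d', h1, ?_⟩
  let := invariantPseudoMetricSpace d'
  intro n a f hf δ hδ
  obtain ⟨k, hk⟩ := exists_nat_one_div_lt (show 0 < δ / 4 by positivity)
  set η : ℝ := 1 / ((k : ℝ) + 1) with hη
  have hη0 : 0 < η := by positivity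
  have hr : ∀ i, ∃ r : ℚ, f i < r ∧ (r : ℝ) < f i + η := fun i => exists_rat_btwn (by linarith)
  choose r hr1 hr2 using hr
  -- The first two cases are impossible: `r` exceeds the Katětov function `f` by less than `η`.
  rcases Set.mem_iInter.1 h2 ⟨n, a, r, k⟩ with ⟨i, j, h | h⟩ | ⟨z, hz⟩
  · have h3 : f i - f j ≤ d'.1 (a i, a j) := (hf i j).1
    have := hr1 j
    have := hr2 i
    simp only [← hη] at h
    linarith
  · have h3 : d'.1 (a i, a j) ≤ f i + f j := (hf i j).2
    have := hr1 i
    have := hr1 j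
    simp only [← hη] at h
    linarith
  · refine ⟨z, fun i => ?_⟩
    have h3 := hz i
    simp only [← hη] at h3
    have := hr1 i
    have := hr2 i
    rw [abs_lt] at h3
    change |d'.1 (z, a i) - f i| ≤ δ
    rw [abs_le]
    constructor <;> linarith

/-! ### Approximation by finite groups -/

theorem FreeGroup.finite_norm_le (α : Type*) [Finite α] [DecidableEq α] (n : ℕ) :
    {w : FreeGroup α | w.norm ≤ n}.Finite :=
  .of_finite_image ((List.finite_length_le (α × Bool) n).subset <| by
    rintro _ ⟨w, hw, rfl⟩
    exact hw) FreeGroup.toWord_injective.injOn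

/-- A partial action on a finite set `S` by permutations which agree with left multiplication as
long as one stays in `S` follows the multiplication along a given word, if `S` is large. -/
theorem exists_finite_freeGroup_lift_apply {α Γ : Type*} [Group Γ] (θ : α → Γ) (w : FreeGroup α)
    (s : Γ) : ∃ T : Set Γ, T.Finite ∧ s ∈ T ∧ FreeGroup.lift θ w * s ∈ T ∧
      ∀ (S : Set Γ), T ⊆ S → ∀ σ : α → Equiv.Perm S,
        (∀ a (x y : S), θ a * x.1 = y.1 → σ a x = y) →
        ∀ x y : S, x.1 = s → FreeGroup.lift θ w * s = y.1 → FreeGroup.lift σ w x = y := by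
  induction w using FreeGroup.induction_on generalizing s with
  | C1 =>
    refine ⟨{s}, Set.finite_singleton s, rfl, by simp, fun S _ σ _ x y hx hy => ?_⟩
    simpa [Subtype.ext_iff, hx] using hy
  | of a =>
    refine ⟨{s, θ a * s}, by simp, by simp, by simp, fun S _ σ hσ x y hx hy => ?_⟩
    simp only [FreeGroup.lift_apply_of] at hy ⊢
    exact hσ a x y (by rw [hx, hy])
  | inv_of a _ =>
    refine ⟨{s, (θ a)⁻¹ * s}, by simp, by simp, by simp, fun S _ σ hσ x y hx hy => ?_⟩
    simp only [map_inv, FreeGroup.lift_apply_of] at hy ⊢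
    rw [Equiv.Perm.inv_eq_iff_eq, eq_comm]
    exact hσ a y x (by rw [hx, ← hy, mul_inv_cancel_left])
  | mul w₁ w₂ h₁ h₂ =>
    obtain ⟨T₂, hT₂, hs₂, hs₂', h₂⟩ := h₂ s
    obtain ⟨T₁, hT₁, hs₁, hs₁', h₁⟩ := h₁ (FreeGroup.lift θ w₂ * s)
    refine ⟨T₁ ∪ T₂, hT₁.union hT₂, Or.inr hs₂, Or.inl (by rwa [map_mul, mul_assoc]),
      fun S hS σ hσ x y hx hy => ?_⟩
    rw [map_mul, mul_assoc] at hy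
    let z : S := ⟨FreeGroup.lift θ w₂ * s, hS (Or.inr hs₂')⟩
    rw [map_mul, Equiv.Perm.mul_apply,
      h₂ S (Set.subset_union_right.trans hS) σ hσ x z hx rfl,
      h₁ S (Set.subset_union_left.trans hS) σ hσ z y rfl hy]

/-- Left multiplication by `t`, restricted to a partial injection of a finite set `S`, extends to a
permutation of `S`. -/
theorem exists_perm_mul_left {Γ : Type*} [Group Γ] {S : Set Γ} (hS : S.Finite) (t : Γ) :
    ∃ σ : Equiv.Perm S, ∀ x y : S, t * x.1 = y.1 → σ x = y := by
  have := hS.to_subtype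
  let e : {x : S // t * x.1 ∈ S} ≃ {y : S // t⁻¹ * y.1 ∈ S} :=
    { toFun x := ⟨⟨t * x.1.1, x.2⟩, by simp⟩
      invFun y := ⟨⟨t⁻¹ * y.1.1, y.2⟩, by simp⟩
      left_inv x := by simp
      right_inv y := by simp }
  classical
  have := Fintype.ofFinite S
  refine ⟨e.extendSubtype, fun x y h => ?_⟩
  rw [e.extendSubtype_apply_of_mem x (by rw [h]; exact y.2)]
  exact Subtype.ext h

/-- A homomorphism from the free product of a finite group `F` and an infinite cyclic group, which
is represented by the generators `Option F`, to a group `Γ` is approximated on a finite set `W` by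
a homomorphism to a finite group containing `F`. -/
theorem exists_finite_group_lift {F : Type u} [Group F] [Finite F] {Γ : Type v} [Group Γ]
    {j : F →* Γ} (hj : Function.Injective j) (t : Γ) {W : Set (FreeGroup (Option F))}
    (hW : W.Finite) :
    ∃ (F' : Type u) (_ : Group F') (_ : Finite F') (ι : F →* F') (τ : F'),
      Function.Injective ι ∧ ∀ w ∈ W,
        FreeGroup.lift (fun o : Option F => o.elim τ ι) w = 1 →
          FreeGroup.lift (fun o : Option F => o.elim t j) w = 1 := by
  let θ : Option F → Γ := fun o => o.elim t j
  choose T hT h1T hwT hTσ using fun w => exists_finite_freeGroup_lift_apply θ w 1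
  let S₀ : Set Γ := insert 1 (⋃ w ∈ W, T w)
  have hS₀ : S₀.Finite := (hW.biUnion fun w _ => hT w).insert 1
  -- Saturating under left multiplication by `F` lets `F` act on `S` genuinely, while `t` only gives
  -- a partial injection, completed to a permutation. Following a word `w` from `1` inside `S` then
  -- computes its value in `Γ`.
  let S : Set Γ := Set.image2 (fun f s => j f * s) Set.univ S₀
  have hS : S.Finite := Set.Finite.image2 _ Set.finite_univ hS₀
  have hS₀S : S₀ ⊆ S := fun s hs => ⟨1, trivial, s, hs, by simp⟩
  have h1S : (1 : Γ) ∈ S := hS₀S (Set.mem_insert _ _)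
  have hjS : ∀ f, ∀ s ∈ S, j f * s ∈ S := by
    rintro f _ ⟨f', -, s, hs, rfl⟩
    exact ⟨f * f', trivial, s, hs, by simp [mul_assoc]⟩
  obtain ⟨τ, hτ⟩ := exists_perm_mul_left hS t
  let ι : F →* Equiv.Perm S :=
    { toFun f :=
        { toFun s := ⟨j f * s, hjS f s s.2⟩
          invFun s := ⟨j f⁻¹ * s, hjS f⁻¹ s s.2⟩
          left_inv s := by simp
          right_inv s := by simp }
      map_one' := by ext; simp
      map_mul' f f' := by ext; simp [mul_assoc] }
  have hι : Function.Injective ι := fun f f' h => hj <| by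
    have := congrArg (fun σ : Equiv.Perm S => (σ ⟨1, h1S⟩).1) h
    simpa [ι] using this
  have := hS.to_subtype
  -- The permutation group lives in the universe of `Γ`; being finite, it can be moved to the
  -- universe of `F`, where the extension property of Hall's group applies.
  let e := (Shrink.mulEquiv.{u} (α := Equiv.Perm S)).symm
  refine ⟨Shrink.{u} (Equiv.Perm S), inferInstance, inferInstance, e.toMonoidHom.comp ι, e τ,
    e.injective.comp hι, fun w hw h => ?_⟩
  have hcomp : FreeGroup.lift (fun o : Option F => o.elim (e τ) (e.toMonoidHom.comp ι)) =
      e.toMonoidHom.comp (FreeGroup.lift fun o : Option F => o.elim τ ι) := by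
    ext (_ | f) <;> simp
  rw [hcomp, MonoidHom.comp_apply] at h
  replace h : FreeGroup.lift (fun o : Option F => o.elim τ ι) w = 1 := e.injective (by simpa using h)
  have hTS : T w ⊆ S := (Set.subset_biUnion_of_mem (u := T) hw).trans
    ((Set.subset_insert _ _).trans hS₀S)
  have key := hTσ w S hTS (fun o => o.elim τ ι) (by
    rintro (_ | f) x y hxy
    · exact hτ x y hxy
    · exact Subtype.ext hxy) ⟨1, h1S⟩ ⟨_, hTS (hwT w)⟩ rfl rfl
  rw [h, Equiv.Perm.one_apply, Subtype.ext_iff] at key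
  simpa using key.symm

/-! ### From words to an invariant pseudometric -/

/-- Given an isometric action `Θ` of a free group and a homomorphism `Ψ` of the free group to `G`
whose kernel meets a large ball inside the kernel of `Θ`, there is a `G`-invariant pseudometric on
`G × ℕ` imitating the distances in the orbits of the points `x i` under the generators. -/
theorem exists_invariantPseudometric_of_freeGroup {G : Type*} [Group G] {α : Type*}
    [DecidableEq α] (Ψ : FreeGroup α →* G) {U : Type*} [PseudoMetricSpace U]
    (Θ : FreeGroup α →* (U ≃ᵢ U)) (x : ℕ → U) {ε C : ℝ} (hε : 0 < ε) (hC : 0 ≤ C)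
    (hker : ∀ w : FreeGroup α, ε * w.norm ≤ C + 2 * ε → Ψ w = 1 → Θ w = 1) :
    ∃ d : invariantPseudometrics G, ∀ a b i j,
      dist (Θ (.of a) (x i)) (Θ (.of b) (x j)) ≤ C →
        |d.1 ((Ψ (.of a), i), (Ψ (.of b), j)) - dist (Θ (.of a) (x i)) (Θ (.of b) (x j))|
          ≤ 2 * ε := by
  classical
  -- The penalty `ε * w.norm` makes long words useless once values are truncated at `C`, so only
  -- relations of bounded length matter.
  let ρ : FreeGroup α → ℕ → ℕ → ℝ := fun w i j => dist (x i) (Θ w (x j)) + ε * w.norm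
  have hρ0 : ∀ w i j, 0 ≤ ρ w i j := fun w i j => by positivity
  have hρinv : ∀ w i j, ρ w⁻¹ i j = ρ w j i := fun w i j => by
    simp only [ρ, FreeGroup.norm_inv_eq]
    rw [← (Θ w).dist_eq, ← IsometryEquiv.mul_apply, ← map_mul, mul_inv_cancel, map_one,
      IsometryEquiv.coe_one, id, dist_comm]
  have hρmul : ∀ w w' i j k, ρ (w * w') i k ≤ ρ w i j + ρ w' j k := fun w w' i j k => by
    have h1 := dist_triangle (x i) (Θ w (x j)) (Θ (w * w') (x k))
    rw [map_mul, IsometryEquiv.mul_apply, (Θ w).dist_eq] at h1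
    have h2 : ((w * w').norm : ℝ) ≤ w.norm + w'.norm := mod_cast FreeGroup.norm_mul_le w w'
    have h3 := mul_le_mul_of_nonneg_left h2 hε.le
    simp only [ρ, map_mul, IsometryEquiv.mul_apply]
    linarith
  let v : FreeGroup α → G × ℕ → G × ℕ → ℝ := fun w p q =>
    if Ψ w = p.1⁻¹ * q.1 then min C (ρ w p.2 q.2) else C
  have hv0 : ∀ w p q, 0 ≤ v w p q := fun w p q => by
    simp only [v]
    split_ifs
    exacts [le_min hC (hρ0 _ _ _), hC]
  have hvC : ∀ w p q, v w p q ≤ C := fun w p q => by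
    simp only [v]
    split_ifs
    exacts [min_le_left _ _, le_rfl]
  have hbdd : ∀ p q, BddBelow (Set.range fun w => v w p q) := fun p q =>
    ⟨0, by rintro _ ⟨w, rfl⟩; exact hv0 w p q⟩
  let d : (G × ℕ) × (G × ℕ) → ℝ := fun y => ⨅ w, v w y.1 y.2
  have hdv : ∀ w p q, d (p, q) ≤ v w p q := fun w p q => ciInf_le (hbdd p q) w
  have hd0 : ∀ p q, 0 ≤ d (p, q) := fun p q => le_ciInf fun w => hv0 w p q
  refine ⟨⟨d, fun p => ?_, fun p q => ?_, fun p q r => ?_, fun g p q => ?_⟩,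
    fun a b i j hab => ?_⟩
  · refine le_antisymm ((hdv 1 p p).trans ?_) (hd0 p p)
    simp [v, ρ]
  · refine (Equiv.inv (FreeGroup α)).iInf_congr fun w => ?_
    change v w⁻¹ q p = v w p q
    have : Ψ w⁻¹ = q.1⁻¹ * p.1 ↔ Ψ w = p.1⁻¹ * q.1 := by
      rw [map_inv, inv_eq_iff_eq_inv, mul_inv_rev, inv_inv]
    simp only [v, this, hρinv]
  · refine le_ciInf_add_ciInf fun w w' => ?_
    by_cases h : Ψ w = p.1⁻¹ * q.1
    · by_cases h' : Ψ w' = q.1⁻¹ * r.1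
      · refine (hdv (w * w') p r).trans ?_
        have h'' : Ψ (w * w') = p.1⁻¹ * r.1 := by rw [map_mul, h, h']; group
        simp only [v, if_pos h, if_pos h', if_pos h'']
        have h1 := hρmul w w' p.2 q.2 r.2
        have h2 := hρ0 w p.2 q.2
        have h3 := hρ0 w' q.2 r.2
        rcases le_total C (ρ w p.2 q.2) with h4 | h4
        · rw [min_eq_left h4]
          exact (min_le_left _ _).trans (le_add_of_nonneg_right (le_min hC h3))
        · rcases le_total C (ρ w' q.2 r.2) with h5 | h5
          · rw [min_eq_left h5]
            exact (min_le_left _ _).trans (le_add_of_nonneg_left (le_min hC h2))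
          · rw [min_eq_right h4, min_eq_right h5]
            exact (min_le_right _ _).trans h1
      · refine ((hdv 1 p r).trans (hvC _ _ _)).trans ?_
        rw [show v w' q r = C from if_neg h']
        exact le_add_of_nonneg_left (hv0 _ _ _)
    · refine ((hdv 1 p r).trans (hvC _ _ _)).trans ?_
      rw [show v w p q = C from if_neg h]
      exact le_add_of_nonneg_right (hv0 _ _ _)
  · refine iInf_congr fun w => ?_
    simp only [v, mul_inv_rev, mul_assoc, inv_mul_cancel_left]
  -- The word `k` itself gives the upper bound with error `ε * k.norm ≤ 2 * ε`. For the lower bound,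
  -- a word `w` with the same image either costs at least `C`, or is short enough for `w * k⁻¹` to
  -- lie in the kernel of `Θ`, so that `Θ w = Θ k`.
  · let k : FreeGroup α := (.of a)⁻¹ * .of b
    have hk : k.norm ≤ 2 := (FreeGroup.norm_mul_le _ _).trans (by
      rw [FreeGroup.norm_inv_eq, FreeGroup.norm_of, FreeGroup.norm_of])
    have hΨk : Ψ k = (Ψ (.of a))⁻¹ * Ψ (.of b) := by rw [map_mul, map_inv]
    have hΘk : dist (x i) (Θ k (x j)) = dist (Θ (.of a) (x i)) (Θ (.of b) (x j)) := by
      rw [← (Θ (.of a)).dist_eq, ← IsometryEquiv.mul_apply (Θ (.of a)) (Θ k), ← map_mul,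
        mul_inv_cancel_left]
    have hk' : (k.norm : ℝ) ≤ 2 := mod_cast hk
    rw [← hΘk] at hab ⊢
    change |d ((Ψ (.of a), i), (Ψ (.of b), j)) - _| ≤ _
    rw [abs_le]
    constructor
    · have : dist (x i) (Θ k (x j)) ≤ d ((Ψ (.of a), i), (Ψ (.of b), j)) := by
        refine le_ciInf fun w => ?_
        simp only [v]
        split_ifs with hw
        · refine le_min hab ?_
          rcases le_total C (ε * w.norm) with h | h
          · exact (hab.trans h).trans (le_add_of_nonneg_left dist_nonneg)
          · have h1 : Θ (w * k⁻¹) = 1 := by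
              refine hker _ ?_ (by rw [map_mul, map_inv, hw, hΨk, mul_inv_cancel])
              have h2 : ((w * k⁻¹).norm : ℝ) ≤ w.norm + 2 := by
                have := FreeGroup.norm_mul_le w k⁻¹
                rw [FreeGroup.norm_inv_eq] at this
                exact_mod_cast this.trans (Nat.add_le_add_left hk _)
              have h3 := mul_le_mul_of_nonneg_left h2 hε.le
              linarith
            rw [map_mul, map_inv, mul_inv_eq_one] at h1
            simp only [ρ, h1]
            exact le_add_of_nonneg_right (by positivity)
        · exact hab
      linarith
    · have h1 := hdv k (Ψ (.of a), i) (Ψ (.of b), j)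
      have h2 : v k (Ψ (.of a), i) (Ψ (.of b), j) ≤ ρ k i j := by
        simp only [v, if_pos hΨk]
        exact min_le_right _ _
      have h3 := mul_le_mul_of_nonneg_left hk' hε.le
      simp only [ρ] at h2
      linarith

/-! ### Actions on the Urysohn space and genericity -/

/-- The completion of `G × ℕ` with respect to an invariant pseudometric, with the action of `G`. -/
theorem exists_isometric_action_completion {G : Type u} [Group G] [Countable G]
    (d : invariantPseudometrics G) (hd : @ApproxExtension _ (invariantPseudoMetricSpace d)) :
    ∃ (V : Type u) (_ : MetricSpace V), CompleteSpace V ∧ TopologicalSpace.SeparableSpace V ∧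
      ExactExtension V ∧ ∃ (i : G × ℕ → V) (β : G →* (V ≃ᵢ V)),
        (∀ p q, dist (i p) (i q) = d.1 (p, q)) ∧ ∀ g p, β g (i p) = i (g * p.1, p.2) := by
  let := invariantPseudoMetricSpace d
  let V := UniformSpace.Completion (G × ℕ)
  let i : G × ℕ → V := fun p => (p : V)
  have hi : Isometry i := UniformSpace.Completion.coe_isometry
  have hid : DenseRange i := UniformSpace.Completion.denseRange_coe
  let m : G → G × ℕ ≃ G × ℕ := fun g => (Equiv.mulLeft g).prodCongr (Equiv.refl ℕ)
  have hm : ∀ g p, m g p = (g * p.1, p.2) := fun g p => rfl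
  have hmi : ∀ g, Isometry (m g) := fun g => Isometry.of_dist_eq fun p q => d.2.2.2.2 g p q
  have hβ : ∀ g, ∃ η : V ≃ᵢ V, ∀ p, η (i p) = i (m g p) := fun g =>
    exists_isometryEquiv_of_dense hi (hi.comp (hmi g)) hid
      (hid.comp (m g).surjective.denseRange (UniformSpace.Completion.continuous_coe _))
  choose β hβ using hβ
  refine ⟨V, inferInstance, inferInstance, ⟨Set.range i, Set.countable_range i, hid⟩,
    (hd.of_dense hi hid).exactExtension, i, MonoidHom.mk' β fun g h => ?_,
    fun p q => hi.dist_eq p q, hβ⟩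
  ext y
  refine congrFun (hid.equalizer (β (g * h)).continuous (β g * β h).continuous ?_) y
  funext p
  simp [hβ, hm, mul_assoc]

/-- Any isometric action of a finite subgroup `F` of Hall's group, together with an isometry `φ`,
can be approximated on a finite set by the action of `F` and of one further element in an action of
the whole group. -/
theorem IsHallGroup.exists_hom_dist_lt {G : Type u} [Group G] (hG : IsHallGroup G)
    {U : Type v} [MetricSpace U] [CompleteSpace U] [TopologicalSpace.SeparableSpace U]
    (hU : ExactExtension U) (F : Subgroup G) [Finite F] (θ : F →* (U ≃ᵢ U)) (φ : U ≃ᵢ U)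
    {P : Set U} (hP : P.Finite) {ε : ℝ} (hε : 0 < ε) :
    ∃ (α : G →* (U ≃ᵢ U)) (g : G), (∀ f : F, ∀ x ∈ P, dist (α f x) (θ f x) < ε) ∧
      ∀ x ∈ P, dist (α g x) (φ x) < ε := by
  classical
  have := hG.countable
  have := hP.to_subtype
  obtain ⟨y⟩ := hU.nonempty
  obtain ⟨e, he⟩ := Countable.exists_injective_nat P
  let x : ℕ → U := Function.extend e Subtype.val fun _ => y
  have hx : ∀ p, x (e p) = p := fun p => he.extend_apply _ _ p
  let Θ : FreeGroup (Option F) →* (U ≃ᵢ U) := FreeGroup.lift fun o => o.elim φ θ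
  -- The second factor makes `j` injective even when `θ` is not faithful.
  let j : F →* (U ≃ᵢ U) × F := θ.prod (MonoidHom.id F)
  have hj : Function.Injective j := fun a b h => congrArg Prod.snd h
  obtain ⟨c, hc⟩ := (Set.finite_range fun z : (Option F × P) × (Option F × P) =>
    dist (Θ (.of z.1.1) z.1.2) (Θ (.of z.2.1) z.2.2)).bddAbove
  let C := max c 0
  let δ := ε / 10
  have hδ : 0 < δ := by positivity
  -- This is the length of words up to which `exists_invariantPseudometric_of_freeGroup` needs
  -- control of the kernel.
  obtain ⟨M, hM⟩ := exists_nat_ge ((C + 2 * δ) / δ)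
  obtain ⟨F', _, _, ι, τ, hι, hW⟩ := exists_finite_group_lift hj ((φ, 1) : (U ≃ᵢ U) × F)
    (FreeGroup.finite_norm_le (Option F) M)
  obtain ⟨σ, hσ, hσι⟩ := hG.extension F F' F.subtype ι F.subtype_injective hι
  let Ψ : FreeGroup (Option F) →* G := FreeGroup.lift fun o => o.elim (σ τ) F.subtype
  have hΨ : Ψ = σ.comp (FreeGroup.lift fun o : Option F => o.elim τ ι) := by
    ext (_ | f)
    · simp [Ψ]
    · simpa [Ψ] using (DFunLike.congr_fun hσι f).symm
  have hΘ : Θ = (MonoidHom.fst _ _).comp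
      (FreeGroup.lift fun o : Option F => o.elim ((φ, 1) : (U ≃ᵢ U) × F) j) := by
    refine FreeGroup.ext_hom _ _ ?_
    rintro (_ | f) <;> simp [Θ, j]
  obtain ⟨d, hd⟩ := exists_invariantPseudometric_of_freeGroup Ψ Θ x hδ (le_max_right c 0)
    fun w hw hΨw => by
      rw [hΨ, MonoidHom.comp_apply] at hΨw
      rw [hΘ, MonoidHom.comp_apply, hW w ?_ (hσ (by rw [hΨw, map_one])), map_one]
      have : (w.norm : ℝ) ≤ (C + 2 * δ) / δ := by
        rw [le_div_iff₀ hδ, mul_comm]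
        exact hw
      exact_mod_cast this.trans hM
  let s : Option F × P → G × ℕ := fun z => (Ψ (.of z.1), e z.2)
  obtain ⟨d', hd', hd'a⟩ := exists_invariantPseudometric_approxExtension d
    (Set.finite_range s) hδ
  obtain ⟨V, _, _, _, hV, i, β, hi, hβ⟩ := exists_isometric_action_completion d' hd'a
  -- Distances are off by at most `2 * δ` from the word pseudometric plus `δ` from the generic
  -- perturbation; the matching error is half of this.
  obtain ⟨η, hη⟩ := exists_isometryEquiv_dist_le hV hU (J := Option F × P)
    (p := fun z => i (s z)) (u := fun z => Θ (.of z.1) z.2) (ε := 3 * δ / 2) (by positivity)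
    fun z z' => by
      have h1 := abs_lt.1 (hd' (s z) ⟨z, rfl⟩ (s z') ⟨z', rfl⟩)
      have h2 := hd z.1 z'.1 (e z.2) (e z'.2)
      rw [hx, hx] at h2
      have h3 := abs_le.1 (h2 ((hc ⟨(z, z'), rfl⟩).trans (le_max_left _ _)))
      rw [hi, abs_le]
      constructor <;> linarith
  let α : G →* (U ≃ᵢ U) := MonoidHom.mk' (fun g => (η.symm.trans (β g)).trans η) fun g h => by
    ext z
    simp
  have hα : ∀ g z, α g (η z) = η (β g z) := fun g z => by simp [α]
  -- The point indexed by `(some 1, p)` stands for `p` itself, and `Ψ (.of o)` carries it exactly to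
  -- the one indexed by `(o, p)`. Both are matched up to `3 * δ / 2`, for a total of `3 * δ < ε`.
  have key : ∀ (o : Option F) (p : P), dist (α (Ψ (.of o)) p) (Θ (.of o) p) < ε := fun o p => by
    have h1 := hη (some 1, p)
    have h2 := hη (o, p)
    have h3 : Θ (.of (some 1)) p = p := by simp [Θ]
    have h4 : α (Ψ (.of o)) (η (i (s (some 1, p)))) = η (i (s (o, p))) := by
      rw [hα, hβ]
      simp [s, Ψ]
    simp only [h3] at h1
    rw [← (α (Ψ (.of o))).dist_eq, h4, dist_comm] at h1
    have h5 := dist_triangle (α (Ψ (.of o)) p) (η (i (s (o, p)))) (Θ (.of o) p)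
    have : 3 * δ < ε := by simp only [δ]; linarith
    linarith
  refine ⟨α, Ψ (.of none), fun f p hp => ?_, fun p hp => ?_⟩
  · simpa [Ψ, Θ] using key (some f) ⟨p, hp⟩
  · simpa only [Θ, FreeGroup.lift_apply_of, Option.elim] using key none ⟨p, hp⟩

/-- For a nonempty open set `O` of isometries, the homomorphisms whose range meets `O` form a dense
open set. -/
theorem IsHallGroup.isOpen_dense_range_meets {G : Type u} [Group G] (hG : IsHallGroup G)
    {U : Type v} [MetricSpace U] [CompleteSpace U] [TopologicalSpace.SeparableSpace U]
    (hU : ExactExtension U) {O : Set (U ≃ᵢ U)} (hO : IsOpen O) (hne : O.Nonempty) :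
    IsOpen {α : G →* (U ≃ᵢ U) | ∃ g, α g ∈ O} ∧ Dense {α : G →* (U ≃ᵢ U) | ∃ g, α g ∈ O} := by
  constructor
  · rw [Set.ofPred_exists]
    exact isOpen_iUnion fun g => hO.preimage (continuous_hom_apply g)
  · refine dense_iff_inter_open.2 fun N hN ⟨α₀, hα₀⟩ => ?_
    obtain ⟨φ, hφ⟩ := hne
    obtain ⟨T, P, ε, hT, hP, hε, hN'⟩ := exists_finite_dist_lt_of_mem_nhds_hom (hN.mem_nhds hα₀)
    obtain ⟨P', ε', hP', hε', hO'⟩ := exists_finite_dist_lt_of_mem_nhds (hO.mem_nhds hφ)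
    -- Local finiteness reduces the neighbourhood of `α₀` to a condition on the action of a finite
    -- subgroup.
    have : Finite (Subgroup.closure T) := hG.locallyFinite _
      ((Subgroup.fg_iff _).2 ⟨T, rfl, hT⟩)
    obtain ⟨α, g, h1, h2⟩ := hG.exists_hom_dist_lt hU (Subgroup.closure T)
      (α₀.comp (Subgroup.closure T).subtype) φ (hP.union hP') (lt_min hε hε')
    exact ⟨α, hN' α fun t ht x hx =>
      (h1 ⟨t, Subgroup.subset_closure ht⟩ x (Or.inl hx)).trans_le (min_le_left _ _),
      g, hO' _ fun x hx => (h2 x (Or.inr hx)).trans_le (min_le_right _ _)⟩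

/-- The generic homomorphism of Hall's group to the isometry group of the Urysohn space has dense
range. -/
theorem IsHallGroup.eventually_residual_denseRange {G : Type u} [Group G] (hG : IsHallGroup G)
    {U : Type v} [MetricSpace U] [CompleteSpace U] [TopologicalSpace.SeparableSpace U]
    (hU : ExactExtension U) :
    ∀ᶠ α : G →* (U ≃ᵢ U) in residual (G →* (U ≃ᵢ U)), DenseRange α := by
  have := hU.nonempty
  have := polishSpace_isometryEquiv U
  have h : ∀ᶠ α : G →* (U ≃ᵢ U) in residual (G →* (U ≃ᵢ U)),
      ∀ O ∈ TopologicalSpace.countableBasis (U ≃ᵢ U), ∃ g, α g ∈ O := by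
    refine (eventually_countable_ball (TopologicalSpace.countable_countableBasis _)).2
      fun O hO => ?_
    obtain ⟨h1, h2⟩ := hG.isOpen_dense_range_meets hU
      (TopologicalSpace.isOpen_of_mem_countableBasis hO)
      (TopologicalSpace.nonempty_of_mem_countableBasis hO)
    exact residual_of_dense_open h1 h2
  filter_upwards [h] with α hα
  refine (TopologicalSpace.isBasis_countableBasis _).dense_iff.2 fun O hO _ => ?_
  obtain ⟨g, hg⟩ := hα O hO
  exact ⟨α g, hg, g, rfl⟩

theorem mainTheorem5 (G : Type u) [Group G] (hG : IsHallGroup G)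
    (U : Type v) [MetricSpace U] (hU : IsUrysohnSpace U) :
    ∃ (H : Type v) (_ : Group H) (_ : TopologicalSpace H),
      IsTopologicalGroup H ∧ PolishSpace H ∧
        ∀ᶠ α : G →* (U ≃ᵢ U) in residual (G →* (U ≃ᵢ U)),
          Nonempty (α.range.topologicalClosure ≃ₜ* H) := by
  have := hU.complete
  have := hU.separableSpace
  have := hU.exactExtension.nonempty
  refine ⟨U ≃ᵢ U, inferInstance, inferInstance, inferInstance, polishSpace_isometryEquiv U, ?_⟩
  filter_upwards [hG.eventually_residual_denseRange hU.exactExtension] with α hα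
  have h : α.range.topologicalClosure = ⊤ := by
    refine SetLike.coe_injective ?_
    rw [Subgroup.topologicalClosure_coe, MonoidHom.coe_range, hα.closure_range, Subgroup.coe_top]
  rw [h]
  exact ⟨{ Subgroup.topEquiv with
    continuous_toFun := continuous_subtype_val
    continuous_invFun := continuous_id.subtype_mk _ }⟩
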